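/- Fix an integer $m\ge 1$. For $n\ge 1$ let a deck be drawn uniformly at random from all words of length $nm$ in the letters (card types) $1,\dots,n$ in which every letter occurs exactly $m$ times. The cards are dealt one at a time from the top; before each card is dealt a player, who knows all the cards dealt so far, guesses its type (any of the $n$ types may be guessed), after which the card is revealed and removed. A strategy is a rule assigning to each finite sequence of revealed cards the type to be guessed next. Let $\mathbb{E}[S^-_{n,m}]$ be the expected number of correct guesses under a worst strategy, that is, the minimum over all strategies of the expected number of correct guesses (this minimum is attained). Put $\gamma_j=\binom{m}{j}^{1/j}$. Then there is a constant $C$ depending only on $m$ such that for all $n\ge 2$ $$\left|\,\mathbb{E}[S^-_{n,m}]-\sum_{j=\lfloor m/2\rfloor+1}^{m}\frac{\Gamma\left(\frac{j+1}{j}\right)}{\gamma_j\,n^{1/j}}\right|\le C\,n^{-2/m}\log^2 n .$$ In particular, as $n\to\infty$ with $m$ fixed, $$\mathbb{E}[S^-_{n,m}]\sim\Gamma\left(\frac{m+1}{m}\right)n^{-1/m}.$$ -/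

import Mathlib

open Filter Asymptotics

/-- The even decks with `n` card types, each of multiplicity `m`: words of length `n * m` in the
letters `Fin n` in which every letter occurs exactly `m` times. Position `0` is the top card. -/
def evenDecks (n m : ℕ) : Finset (Fin (n * m) → Fin n) :=
  Finset.univ.filter fun d => ∀ i : Fin n, (Finset.univ.filter fun s => d s = i).card = m

/-- A guessing strategy with complete feedback: given the list of the cards revealed so far
(in the order in which they were revealed), it names the type to be guessed next.
Any of the `n` types may be guessed, including one that is already exhausted. -/
abbrev GuessStrategy (n : ℕ) : Type := List (Fin n) → Fin n

/-- The number of correct guesses when the deck `d` is dealt from the top: the guess for the card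
in position `t` is made knowing the cards in positions `0, …, t - 1`. -/
def correctGuesses {n m : ℕ} (σ : GuessStrategy n) (d : Fin (n * m) → Fin n) : ℕ :=
  (Finset.univ.filter fun t : Fin (n * m) => σ ((List.ofFn d).take (t : ℕ)) = d t).card

/-- The expected number of correct guesses of a strategy on a uniformly random even deck. -/
noncomputable def expectedCorrect (n m : ℕ) (σ : GuessStrategy n) : ℝ :=
  (∑ d ∈ evenDecks n m, (correctGuesses σ d : ℝ)) / ((evenDecks n m).card : ℝ)

/-- The expected number of correct guesses under a worst strategy, i.e. the minimum (which is
attained as soon as `1 ≤ n`) of `expectedCorrect n m` over all strategies. -/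
noncomputable def worstExpected (n m : ℕ) : ℝ :=
  ⨅ σ : GuessStrategy n, expectedCorrect n m σ

/-- `γ_j = (m choose j) ^ (1 / j)`. -/
noncomputable def deckGamma (m j : ℕ) : ℝ :=
  (m.choose j : ℝ) ^ (1 / (j : ℝ))

/-! Given the revealed cards, the unseen positions are exchangeable. A guess at time `t` is
therefore correct with probability equal to the number of unseen copies of the guessed type over `n
* m - t`. The worst choice is a type seen most often, with `m - M` copies left, where `M` is the
largest count so far. Write `m - M` as the number of levels `1 ≤ j ≤ m` with `M < j`. The minimum
becomes a sum over `j` and `t` of P(`M < j`) / (`n * m - t`). Dealing the cards at independent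
uniform times decouples the types: at time `x`, P(`M < j`) is `Q ^ n`, with `Q = binomialLower m j
x`. The Beta integral produces the weight 1 / (`n * m - t`), so level `j` contributes exactly ∫₀¹ `Q
^ n / (1 - x)` (`sum_card_sparseDecks_div`). Near 0, `Q` is 1 - (m choose j) x^j + O(x^(j+1)), and
everywhere `Q ≤ exp (-x ^ j)`. Comparison with ∫ exp(-(m choose j) n x^j) over (0, ∞) gives the
Gamma term with error O(n^(-2/j)). Main terms with `j ≤ m / 2` are themselves O(n^(-2/m)). -/

/-! ### Even decks, exchangeability and the generating polynomial of sparse decks -/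

section Combinatorics

open Finset

/-- The first `t` positions of a deck with `N` cards. -/
def initialPositions (N t : ℕ) : Finset (Fin N) :=
  univ.filter fun s => (s : ℕ) < t

theorem card_initialPositions {N t : ℕ} (ht : t ≤ N) : (initialPositions N t).card = t := by
  have h : (initialPositions N t).map Fin.valEmbedding = range t := by
    ext a
    simp only [initialPositions, Finset.mem_map, mem_filter, mem_univ, true_and,
      Fin.valEmbedding_apply,
      mem_range]
    exact ⟨fun ⟨s, hs, hsa⟩ => hsa ▸ hs, fun ha => ⟨⟨a, by omega⟩, ha, rfl⟩⟩
  rw [← card_map Fin.valEmbedding, h, card_range]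

/-- The even decks in which every type occurs fewer than `j` times among the positions in `S`. -/
def sparseDecks (n m j : ℕ) (S : Finset (Fin (n * m))) : Finset (Fin (n * m) → Fin n) :=
  (evenDecks n m).filter fun d => ∀ i, (S.filter fun s => d s = i).card < j

theorem mem_evenDecks {n m : ℕ} {d : Fin (n * m) → Fin n} :
    d ∈ evenDecks n m ↔ ∀ i, (univ.filter fun s => d s = i).card = m := by
  simp [evenDecks]

theorem evenDecks_nonempty (n m : ℕ) : (evenDecks n m).Nonempty := by
  refine ⟨fun s => (finProdFinEquiv.symm s).1, mem_evenDecks.2 fun i => ?_⟩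
  have h : (univ.filter fun s : Fin (n * m) => (finProdFinEquiv.symm s).1 = i)
      = (univ : Finset (Fin m)).map ((Function.Embedding.sectR i (Fin m)).trans
        finProdFinEquiv.toEmbedding) := by
    ext s
    simp only [mem_filter, mem_univ, true_and, Finset.mem_map]
    constructor
    · rintro rfl
      exact ⟨(finProdFinEquiv.symm s).2, by
        show finProdFinEquiv ((finProdFinEquiv.symm s).1, (finProdFinEquiv.symm s).2) = s
        simp [-finProdFinEquiv_symm_apply]⟩
    · rintro ⟨a, rfl⟩
      show (finProdFinEquiv.symm (finProdFinEquiv (i, a))).1 = i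
      rw [Equiv.symm_apply_apply]
  rw [h, card_map, card_univ, Fintype.card_fin]

theorem card_filter_comp_perm {α β : Type*} [DecidableEq β] (e : Equiv.Perm α)
    (S : Finset α) (d : α → β) (i : β) :
    (S.filter fun s => d (e s) = i).card = ((S.map e.toEmbedding).filter fun s => d s = i).card := by
  rw [filter_map, card_map]
  rfl

theorem comp_perm_mem_evenDecks {n m : ℕ} (e : Equiv.Perm (Fin (n * m)))
    {d : Fin (n * m) → Fin n} (hd : d ∈ evenDecks n m) : d ∘ e ∈ evenDecks n m := by
  rw [mem_evenDecks] at hd ⊢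
  intro i
  refine Eq.trans ?_ (hd i)
  simpa using card_filter_comp_perm e univ d i

theorem exists_perm_map_eq {α : Type*} [Fintype α] [DecidableEq α] {S T : Finset α}
    (h : S.card = T.card) : ∃ e : Equiv.Perm α, S.map e.toEmbedding = T := by
  refine ⟨(Finset.equivOfCardEq h).extendSubtype, ?_⟩
  refine eq_of_subset_of_card_le (fun x hx => ?_) (by simp [h])
  obtain ⟨y, hy, rfl⟩ := Finset.mem_map.1 hx
  exact Equiv.extendSubtype_mem _ _ hy

/-- The number of sparse decks depends on the position set only through its size. -/
theorem card_sparseDecks_congr {n m j : ℕ} {S T : Finset (Fin (n * m))} (h : S.card = T.card) :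
    (sparseDecks n m j S).card = (sparseDecks n m j T).card := by
  obtain ⟨e, he⟩ := exists_perm_map_eq h
  refine (card_nbij' (fun d => d ∘ e) (fun d => d ∘ e.symm) ?_ ?_ ?_ ?_).symm
  · intro d hd
    simp only [sparseDecks, coe_filter, Set.mem_ofPred_eq] at hd ⊢
    refine ⟨comp_perm_mem_evenDecks e hd.1, fun i => ?_⟩
    simpa [card_filter_comp_perm, he] using hd.2 i
  · intro d hd
    simp only [sparseDecks, coe_filter, Set.mem_ofPred_eq] at hd ⊢
    refine ⟨comp_perm_mem_evenDecks e.symm hd.1, fun i => ?_⟩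
    have hT : T.map e.symm.toEmbedding = S := by
      rw [← he, Finset.map_map]
      ext
      simp
    simpa [card_filter_comp_perm, hT] using hd.2 i
  · intro d _
    ext
    simp
  · intro d _
    ext
    simp

/-- A sum over subsets of a product of functions of their intersections with the fibres of `d`. -/
theorem sum_powerset_prod_fibres {α β R : Type*} [Fintype α] [DecidableEq α] [Fintype β]
    [DecidableEq β] [CommSemiring R] (d : α → β) (f : β → Finset α → R) :
    ∑ S : Finset α, ∏ i, f i (S.filter fun s => d s = i)
      = ∏ i, ∑ T ∈ (univ.filter fun s => d s = i).powerset, f i T := by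
  rw [prod_univ_sum]
  refine sum_nbij' (fun S i => S.filter fun s => d s = i)
    (fun p => univ.filter fun s => s ∈ p (d s)) ?_ ?_ ?_ ?_ ?_
  · intro S _
    simp only [Fintype.mem_piFinset, mem_powerset]
    exact fun i => filter_subset_filter _ (subset_univ _)
  · simp
  · intro S _
    ext s
    simp
  · intro p hp
    simp only [Fintype.mem_piFinset, mem_powerset] at hp
    ext i s
    simp only [mem_filter, mem_univ, true_and]
    constructor
    · rintro ⟨h, rfl⟩
      exact h
    · intro h
      have := (mem_filter.1 (hp i h)).2
      subst this
      exact ⟨h, rfl⟩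
  · intro S _
    rfl

/-- The probability that a binomial variable with parameters `m` and `x` is less than `j`. -/
noncomputable def binomialLower (m j : ℕ) (x : ℝ) : ℝ :=
  ∑ k ∈ range j, (m.choose k : ℝ) * x ^ k * (1 - x) ^ (m - k)

theorem sum_powerset_binomial {α : Type*} [DecidableEq α] (F : Finset α) {m j : ℕ} (hF : F.card = m)
    (hj : j ≤ m) (x : ℝ) :
    ∑ T ∈ F.powerset, (if T.card < j then x ^ T.card * (1 - x) ^ (m - T.card) else 0)
      = binomialLower m j x := by
  rw [sum_powerset_apply_card (fun k => if k < j then x ^ k * (1 - x) ^ (m - k) else 0), hF,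
    binomialLower]
  simp only [nsmul_eq_mul, mul_ite, mul_zero, ← mul_assoc]
  rw [← sum_filter]
  refine sum_congr ?_ fun _ _ => rfl
  ext k
  simp only [mem_filter, mem_range]
  omega

/-- Keep each position independently with probability `x`. The fibres of `d` are disjoint sets of
size `m`, so their counts are independent binomials and the weight of `S` factors over the types. -/
theorem sum_fibres_evenDeck {n m j : ℕ} (hj : j ≤ m) {d : Fin (n * m) → Fin n}
    (hd : d ∈ evenDecks n m) (x : ℝ) :
    (∑ S : Finset (Fin (n * m)), if ∀ i, (S.filter fun s => d s = i).card < j then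
      x ^ S.card * (1 - x) ^ (n * m - S.card) else 0) = binomialLower m j x ^ n := by
  rw [mem_evenDecks] at hd
  have hf := sum_powerset_prod_fibres d
    (fun _ T => if T.card < j then x ^ T.card * (1 - x) ^ (m - T.card) else 0)
  rw [prod_congr rfl fun i _ => sum_powerset_binomial _ (hd i) hj x, prod_const, card_univ,
    Fintype.card_fin] at hf
  rw [← hf]
  refine sum_congr rfl fun S _ => ?_
  rw [prod_ite_zero]
  simp only [mem_univ, forall_const]
  split_ifs
  · have hS : S.card = ∑ i, (S.filter fun s => d s = i).card :=
      card_eq_sum_card_fiberwise fun _ _ => mem_coe.2 (mem_univ _)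
    have hc : n * m - S.card = ∑ i, (m - (S.filter fun s => d s = i).card) := by
      rw [sum_tsub_distrib]
      · simp [hS]
      · intro i _
        exact (card_le_card (filter_subset_filter _ (subset_univ _))).trans (hd i).le
    rw [prod_mul_distrib, prod_pow_eq_pow_sum, prod_pow_eq_pow_sum, ← hS, ← hc]
  · rfl

/-- Dealing the cards at independent uniform times: the generating polynomial of the numbers of
sparse decks is a power of a binomial lower tail. -/
theorem sum_choose_mul_card_sparseDecks {n m j : ℕ} (hj : j ≤ m) (x : ℝ) :
    ∑ t ∈ range (n * m + 1), ((n * m).choose t : ℝ) * x ^ t * (1 - x) ^ (n * m - t)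
        * (sparseDecks n m j (initialPositions (n * m) t)).card
      = (evenDecks n m).card * binomialLower m j x ^ n := by
  have h1 : ∑ S : Finset (Fin (n * m)), x ^ S.card * (1 - x) ^ (n * m - S.card)
        * (sparseDecks n m j S).card = (evenDecks n m).card * binomialLower m j x ^ n := by
    rw [← nsmul_eq_mul, ← sum_const, ← sum_congr rfl fun d hd => sum_fibres_evenDeck hj hd x,
      sum_comm]
    refine sum_congr rfl fun S _ => ?_
    rw [← sum_filter, sum_const, nsmul_eq_mul, mul_comm]
    rfl
  have h2 := sum_powerset_apply_card (fun t => x ^ t * (1 - x) ^ (n * m - t)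
    * ((sparseDecks n m j (initialPositions (n * m) t)).card : ℝ)) (x := (univ : Finset (Fin (n * m))))
  rw [powerset_univ, card_univ, Fintype.card_fin] at h2
  rw [← h1, sum_congr rfl fun t _ => by rw [mul_assoc, mul_assoc, ← mul_assoc (x ^ t),
    ← nsmul_eq_mul], ← h2]
  refine sum_congr rfl fun S _ => ?_
  rw [card_sparseDecks_congr (card_initialPositions
    (by simpa using card_le_univ S : S.card ≤ n * m))]

end Combinatorics

/-! ### The optimal strategy and the exact minimum -/

section Strategies

open Finset

theorem take_ofFn_comp_swap {N : ℕ} {α : Type*} (d : Fin N → α) {t t' : Fin N} (h : t ≤ t') :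
    (List.ofFn (d ∘ Equiv.swap t t')).take t = (List.ofFn d).take t := by
  refine List.ext_getElem (by simp) fun k hk _ => ?_
  have hkt : k < t := by
    rw [List.length_take] at hk
    omega
  simp only [List.getElem_take, List.getElem_ofFn, Function.comp_apply]
  rw [Equiv.swap_apply_of_ne_of_ne]
  · exact fun he => by simp [← he] at hkt
  · intro he
    have := Fin.le_def.1 h
    rw [← he] at this
    exact absurd this hkt.not_ge

/-- Given the revealed cards, all later positions are equally likely to hold the guessed type. -/
theorem card_guess_eq_later {n m : ℕ} (σ : GuessStrategy n) {t t' : Fin (n * m)} (h : t ≤ t') :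
    ((evenDecks n m).filter fun d => σ ((List.ofFn d).take t) = d t).card
      = ((evenDecks n m).filter fun d => σ ((List.ofFn d).take t) = d t').card := by
  -- Swapping two positions not before `t` leaves the revealed prefix, hence the guess, unchanged.
  refine card_nbij' (fun d => d ∘ Equiv.swap t t') (fun d => d ∘ Equiv.swap t t') ?_ ?_ ?_ ?_
  · intro d hd
    simp only [coe_filter, Set.mem_ofPred_eq, take_ofFn_comp_swap d h] at hd ⊢
    exact ⟨comp_perm_mem_evenDecks _ hd.1, by simpa using hd.2⟩
  · intro d hd
    simp only [coe_filter, Set.mem_ofPred_eq, take_ofFn_comp_swap d h] at hd ⊢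
    exact ⟨comp_perm_mem_evenDecks _ hd.1, by simpa using hd.2⟩
  · intro d _
    ext
    simp
  · intro d _
    ext
    simp

theorem count_take_ofFn {N : ℕ} {α : Type*} [DecidableEq α] (d : Fin N → α) (i : α) {t : ℕ}
    (ht : t ≤ N) :
    ((List.ofFn d).take t).count i
      = ((initialPositions N t).filter fun s => d s = i).card := by
  induction t with
  | zero => simp [initialPositions]
  | succ t ih =>
    have hu : initialPositions N (t + 1) = insert ⟨t, ht⟩ (initialPositions N t) := by
      ext s
      simp only [initialPositions, mem_filter, mem_univ, true_and, mem_insert, Fin.ext_iff]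
      omega
    have hn : (⟨t, ht⟩ : Fin N) ∉ initialPositions N t := by simp [initialPositions]
    rw [List.take_add_one, List.count_append, ih (by omega), hu, filter_insert,
      List.getElem?_ofFn, dif_pos (show t < N by omega)]
    split_ifs with hd
    · rw [card_insert_of_notMem fun hm => hn (mem_filter.1 hm).1]
      simp [hd]
    · simp [hd]

theorem card_remaining {n m : ℕ} {d : Fin (n * m) → Fin n} (hd : d ∈ evenDecks n m) (i : Fin n)
    (t : ℕ) :
    (univ.filter fun s : Fin (n * m) => t ≤ s ∧ d s = i).card
      = m - ((initialPositions (n * m) t).filter fun s => d s = i).card := by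
  have h := mem_evenDecks.1 hd i
  have h2 := card_filter_add_card_filter_not (s := univ.filter fun s => d s = i)
    (fun s : Fin (n * m) => (s : ℕ) < t)
  have e1 : (univ.filter fun s => d s = i).filter (fun s : Fin (n * m) => (s : ℕ) < t)
      = (initialPositions (n * m) t).filter fun s => d s = i := by
    ext s
    simp [initialPositions, and_comm]
  have e2 : (univ.filter fun s => d s = i).filter (fun s : Fin (n * m) => ¬(s : ℕ) < t)
      = univ.filter fun s : Fin (n * m) => t ≤ s ∧ d s = i := by
    ext s
    simp [and_comm]
  rw [e1, e2] at h2
  omega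

/-- Each of the `n * m - t` unseen positions holds the guessed type in equally many decks; summing
over these positions counts its unseen copies deck by deck. -/
theorem remaining_mul_card_guess {n m : ℕ} (σ : GuessStrategy n) (t : Fin (n * m)) :
    (n * m - t) * ((evenDecks n m).filter fun d => σ ((List.ofFn d).take t) = d t).card
      = ∑ d ∈ evenDecks n m, (m - ((List.ofFn d).take t).count (σ ((List.ofFn d).take t))) := by
  calc _ = ∑ t' ∈ univ.filter (fun t' : Fin (n * m) => t ≤ t'),
        ((evenDecks n m).filter fun d => σ ((List.ofFn d).take t) = d t').card := by
        rw [sum_congr rfl fun t' ht' => (card_guess_eq_later σ (mem_filter.1 ht').2).symm,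
          sum_const, smul_eq_mul]
        congr 1
        rw [← Fin.card_Ici t]
        congr 1
        ext s
        simp
    _ = ∑ d ∈ evenDecks n m, (univ.filter fun s : Fin (n * m) =>
          (t : ℕ) ≤ s ∧ d s = σ ((List.ofFn d).take t)).card := by
        simp only [card_filter]
        rw [sum_comm]
        refine sum_congr rfl fun d _ => ?_
        rw [sum_filter]
        refine sum_congr rfl fun s _ => ?_
        simp only [Fin.le_def, eq_comm, ite_and]
    _ = _ := sum_congr rfl fun d hd => by
        rw [card_remaining hd, count_take_ofFn d _ t.2.le]

/-- The proportions of sparse decks, summed over all levels and positions, where a position is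
weighted by the reciprocal of the number of remaining cards. -/
noncomputable def sparseSum (n m : ℕ) : ℝ :=
  (∑ t : Fin (n * m), (∑ j ∈ Icc 1 m,
    ((sparseDecks n m j (initialPositions (n * m) t)).card : ℝ)) / ((n * m : ℕ) - (t : ℕ) : ℝ))
      / (evenDecks n m).card

theorem sum_card_sparseDecks (n m : ℕ) (S : Finset (Fin (n * m))) :
    ∑ j ∈ Icc 1 m, (sparseDecks n m j S).card = ∑ d ∈ evenDecks n m,
      ((Icc 1 m).filter fun j => ∀ i, (S.filter fun s => d s = i).card < j).card := by
  simp only [sparseDecks, card_filter]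
  exact sum_comm

theorem expectedCorrect_eq {n m : ℕ} (σ : GuessStrategy n) :
    expectedCorrect n m σ = (∑ t : Fin (n * m), ((∑ d ∈ evenDecks n m,
      (m - ((List.ofFn d).take t).count (σ ((List.ofFn d).take t))) : ℕ) : ℝ)
        / ((n * m : ℕ) - (t : ℕ) : ℝ)) / (evenDecks n m).card := by
  unfold expectedCorrect
  congr 1
  have h : ∑ d ∈ evenDecks n m, (correctGuesses σ d : ℝ) = ∑ t : Fin (n * m),
      (((evenDecks n m).filter fun d => σ ((List.ofFn d).take t) = d t).card : ℝ) := by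
    simp only [correctGuesses, card_filter, Nat.cast_sum]
    exact sum_comm
  rw [h]
  refine sum_congr rfl fun t _ => ?_
  rw [← remaining_mul_card_guess, Nat.cast_mul, Nat.cast_sub t.2.le, mul_div_cancel_left₀]
  exact (sub_pos.2 (Nat.cast_lt.2 t.2)).ne'

/-- A level `j` exceeding every count exceeds in particular the count of the guessed type, and only
`m - count` levels do that. -/
theorem sparseSum_le_expectedCorrect {n m : ℕ} (σ : GuessStrategy n) :
    sparseSum n m ≤ expectedCorrect n m σ := by
  rw [expectedCorrect_eq, sparseSum]
  refine div_le_div_of_nonneg_right (sum_le_sum fun t _ => ?_) (Nat.cast_nonneg _)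
  refine div_le_div_of_nonneg_right ?_ (sub_nonneg.2 (Nat.cast_le.2 t.2.le))
  rw [← Nat.cast_sum, sum_card_sparseDecks]
  refine Nat.cast_le.2 (sum_le_sum fun d _ => ?_)
  rw [count_take_ofFn d _ t.2.le]
  refine (card_le_card (t := Icc (((initialPositions (n * m) t).filter
    fun s => d s = σ ((List.ofFn d).take t)).card + 1) m) fun j hj => ?_).trans (by simp)
  rw [mem_filter, mem_Icc] at hj
  exact mem_Icc.2 ⟨hj.2 _, hj.1.2⟩

/-- Guessing a type with maximal count turns the inequality between level counts into an equality.
-/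
theorem exists_expectedCorrect_eq {n : ℕ} (m : ℕ) (hn : 1 ≤ n) :
    ∃ σ : GuessStrategy n, expectedCorrect n m σ = sparseSum n m := by
  have : Nonempty (Fin n) := ⟨⟨0, hn⟩⟩
  choose σ hσ using fun l : List (Fin n) => Finite.exists_max fun i => l.count i
  refine ⟨σ, ?_⟩
  rw [expectedCorrect_eq, sparseSum]
  congr 1
  refine sum_congr rfl fun t _ => ?_
  congr 1
  rw [← Nat.cast_sum, sum_card_sparseDecks]
  refine congrArg Nat.cast (sum_congr rfl fun d _ => ?_)
  have h : (Icc 1 m).filter (fun j => ∀ i, ((initialPositions (n * m) t).filter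
        fun s => d s = i).card < j)
      = Icc (((List.ofFn d).take t).count (σ ((List.ofFn d).take t)) + 1) m := by
    ext j
    simp only [mem_filter, mem_Icc, ← count_take_ofFn d _ t.2.le]
    constructor
    · exact fun hj => ⟨hj.2 _, hj.1.2⟩
    · exact fun hj => ⟨⟨by omega, hj.2⟩, fun i => (hσ _ i).trans_lt hj.1⟩
  rw [h, Nat.card_Icc]
  omega

theorem isLeast_sparseSum {n : ℕ} (m : ℕ) (hn : 1 ≤ n) :
    IsLeast (Set.range (expectedCorrect n m)) (sparseSum n m) :=
  ⟨exists_expectedCorrect_eq m hn, by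
    rintro _ ⟨σ, rfl⟩
    exact sparseSum_le_expectedCorrect σ⟩

theorem worstExpected_eq_sparseSum {n : ℕ} (m : ℕ) (hn : 1 ≤ n) :
    worstExpected n m = sparseSum n m :=
  (isLeast_sparseSum m hn).csInf_eq

end Strategies

/-! ### Integral representation of each level -/

section BetaIntegral

open Finset intervalIntegral

theorem integral_pow_mul_one_sub_pow (s r : ℕ) :
    ∫ x in (0 : ℝ)..1, x ^ s * (1 - x) ^ r
      = (s.factorial * r.factorial : ℝ) / (s + r + 1).factorial := by
  have h := Complex.betaIntegral_eq_Gamma_mul_div ((s : ℂ) + 1) ((r : ℂ) + 1)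
    (by simp; positivity) (by simp; positivity)
  rw [Complex.betaIntegral] at h
  simp only [add_sub_cancel_right, Complex.cpow_natCast] at h
  rw [show (s : ℂ) + 1 + (r + 1) = ((s + r + 1 : ℕ) : ℂ) + 1 by push_cast; ring,
    Complex.Gamma_nat_eq_factorial, Complex.Gamma_nat_eq_factorial,
    Complex.Gamma_nat_eq_factorial] at h
  have h2 : ((∫ x in (0 : ℝ)..1, x ^ s * (1 - x) ^ r : ℝ) : ℂ)
      = ∫ x in (0 : ℝ)..1, (x : ℂ) ^ s * (1 - (x : ℂ)) ^ r := by
    rw [← intervalIntegral.integral_ofReal]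
    push_cast
    rfl
  rw [← h2] at h
  rw [← Complex.ofReal_inj, h]
  push_cast
  rfl

theorem choose_mul_integral {N t : ℕ} (ht : t < N) :
    (N.choose t : ℝ) * ∫ x in (0 : ℝ)..1, x ^ t * (1 - x) ^ (N - t - 1) = 1 / ((N : ℝ) - t) := by
  obtain ⟨r, rfl⟩ := Nat.exists_eq_add_of_lt ht
  have hr : t + r + 1 - t - 1 = r := by omega
  have hs : t + r + 1 - t = r + 1 := by omega
  rw [hr, integral_pow_mul_one_sub_pow, Nat.cast_choose ℝ ht.le, hs, Nat.factorial_succ r]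
  have h1 : ((t + r + 1).factorial : ℝ) ≠ 0 := Nat.cast_ne_zero.2 (Nat.factorial_ne_zero _)
  have h2 : (t.factorial : ℝ) ≠ 0 := Nat.cast_ne_zero.2 (Nat.factorial_ne_zero _)
  have h3 : (r.factorial : ℝ) ≠ 0 := Nat.cast_ne_zero.2 (Nat.factorial_ne_zero _)
  have h4 : (r : ℝ) + 1 ≠ 0 := by positivity
  push_cast
  rw [show (t : ℝ) + r + 1 - t = r + 1 by ring]
  field_simp

/-- This kills the term `t = n * m`, so the generating polynomial is divisible by `1 - x`. -/
theorem sparseDecks_univ_eq_empty {n m j : ℕ} (hn : 1 ≤ n) (hj : j ≤ m) :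
    sparseDecks n m j univ = ∅ := by
  refine filter_eq_empty_iff.2 fun d hd h => ?_
  have h1 := h ⟨0, hn⟩
  have h2 := mem_evenDecks.1 hd ⟨0, hn⟩
  exact absurd (h2 ▸ h1 : m < j) hj.not_gt

theorem initialPositions_self (N : ℕ) : initialPositions N N = univ := by
  ext s
  simp [initialPositions]

/-- The contribution of level `j` is the integral of `Q x ^ n / (1 - x)`, where `Q` is the binomial
lower tail. -/
theorem sum_card_sparseDecks_div {n m j : ℕ} (hn : 1 ≤ n) (hj : j ≤ m) :
    (∑ t : Fin (n * m), ((sparseDecks n m j (initialPositions (n * m) t)).card : ℝ)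
        / ((n * m : ℕ) - (t : ℕ) : ℝ)) / (evenDecks n m).card
      = ∫ x in (0 : ℝ)..1, binomialLower m j x ^ n / (1 - x) := by
  have hD : ((evenDecks n m).card : ℝ) ≠ 0 :=
    Nat.cast_ne_zero.2 (card_pos.2 (evenDecks_nonempty n m)).ne'
  set N := n * m with hN
  set c : ℕ → ℝ := fun t => ((sparseDecks n m j (initialPositions N t)).card : ℝ) with hc
  have hcN : c N = 0 := by
    simp only [hc]
    rw [initialPositions_self, sparseDecks_univ_eq_empty hn hj]
    simp
  -- The identity may fail at `x = 1`, where the left side is 0 by the division convention; the open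
  -- interval suffices for the integral.
  have hpoint : ∀ x ∈ Set.Ioo (0 : ℝ) 1, binomialLower m j x ^ n / (1 - x)
      = ∑ t ∈ range N, c t / (evenDecks n m).card
        * ((N.choose t : ℝ) * (x ^ t * (1 - x) ^ (N - t - 1))) := by
    intro x hx
    have hx' : 1 - x ≠ 0 := (sub_pos.2 hx.2).ne'
    have h := sum_choose_mul_card_sparseDecks (n := n) hj x
    change ∑ t ∈ range (N + 1), (N.choose t : ℝ) * x ^ t * (1 - x) ^ (N - t) * c t = _ at h
    rw [sum_range_succ, hcN, mul_zero, add_zero] at h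
    rw [div_eq_iff hx', ← mul_right_inj' hD, ← h, sum_mul, mul_sum]
    refine sum_congr rfl fun t ht => ?_
    have hp : (1 - x) ^ (N - t) = (1 - x) ^ (N - t - 1) * (1 - x) := by
      rw [← pow_succ, Nat.sub_add_cancel]
      have := mem_range.1 ht
      omega
    rw [hp]
    field_simp
  rw [integral_congr_Ioo_of_le zero_le_one hpoint, intervalIntegral.integral_finsetSum, sum_div,
    Fin.sum_univ_eq_sum_range (fun t => c t / ((N : ℕ) - (t : ℕ) : ℝ) / (evenDecks n m).card) N]
  · refine sum_congr rfl fun t ht => ?_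
    rw [intervalIntegral.integral_const_mul, intervalIntegral.integral_const_mul,
      choose_mul_integral (mem_range.1 ht)]
    ring
  · intro t _
    exact Continuous.intervalIntegrable (by fun_prop) _ _

theorem sparseSum_eq_sum_integral {n : ℕ} (m : ℕ) (hn : 1 ≤ n) :
    sparseSum n m = ∑ j ∈ Icc 1 m, ∫ x in (0 : ℝ)..1, binomialLower m j x ^ n / (1 - x) := by
  rw [sum_congr rfl fun j hj => (sum_card_sparseDecks_div hn (mem_Icc.1 hj).2).symm, ← sum_div,
    sum_comm, sparseSum]
  simp only [sum_div]

end BetaIntegral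

/-! ### Bounds on the binomial lower tail -/

section BinomialTail

open Finset

theorem one_sub_binomialLower {m j : ℕ} (hj : j ≤ m) (x : ℝ) :
    1 - binomialLower m j x
      = ∑ k ∈ Ico j (m + 1), (m.choose k : ℝ) * x ^ k * (1 - x) ^ (m - k) := by
  have h := add_pow x (1 - x) m
  rw [add_sub_cancel, one_pow, ← sum_range_add_sum_Ico _ (show j ≤ m + 1 by omega)] at h
  rw [sub_eq_iff_eq_add', binomialLower]
  refine h.trans ?_
  clear h
  congr 1 <;> exact sum_congr rfl fun k _ => by ring

theorem binomialLower_nonneg (m j : ℕ) {x : ℝ} (h0 : 0 ≤ x) (h1 : x ≤ 1) :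
    0 ≤ binomialLower m j x :=
  have := sub_nonneg.2 h1
  sum_nonneg fun _ _ => by positivity

/-- The first `j` of `m` trials all succeed with probability `x ^ j`. Algebraically, expand `x ^ j *
(x + (1 - x)) ^ (m - j)` and compare `(m - j).choose k` with `m.choose (j + k)`. -/
theorem binomialLower_le_one_sub_pow {m j : ℕ} (hj : j ≤ m) {x : ℝ} (h0 : 0 ≤ x) (h1 : x ≤ 1) :
    binomialLower m j x ≤ 1 - x ^ j := by
  have hy := sub_nonneg.2 h1
  rw [le_sub_comm, one_sub_binomialLower hj]
  have h := add_pow x (1 - x) (m - j)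
  rw [add_sub_cancel, one_pow] at h
  rw [sum_Ico_eq_sum_range, Nat.sub_add_comm hj]
  refine (mul_one (x ^ j)).symm.le.trans ?_
  rw [congrArg (x ^ j * ·) h, mul_sum]
  clear h
  refine sum_le_sum fun k hk => ?_
  have hk' : k ≤ m - j := Nat.lt_succ_iff.1 (mem_range.1 hk)
  have hc : ((m - j).choose k : ℝ) ≤ m.choose (j + k) := by
    refine Nat.cast_le.2 ?_
    rw [← Nat.choose_symm hk', ← Nat.choose_symm (by omega : j + k ≤ m), Nat.sub_sub]
    exact Nat.choose_le_choose _ (Nat.sub_le _ _)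
  rw [← Nat.sub_sub]
  calc x ^ j * (x ^ k * (1 - x) ^ (m - j - k) * ((m - j).choose k : ℝ))
      = ((m - j).choose k : ℝ) * (x ^ (j + k) * (1 - x) ^ (m - j - k)) := by ring
    _ ≤ (m.choose (j + k) : ℝ) * (x ^ (j + k) * (1 - x) ^ (m - j - k)) :=
        mul_le_mul_of_nonneg_right hc (by positivity)
    _ = _ := by ring

/-- The terms beyond `k = j` cost at most `2 ^ m * x ^ (j + 1)`; dropping `(1 - x) ^ (m - j)` from
the term `k = j` costs a factor at most `m * x`, by Bernoulli. -/
theorem abs_one_sub_binomialLower_sub_le {m j : ℕ} (hj : j ≤ m) {x : ℝ} (h0 : 0 ≤ x)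
    (h1 : x ≤ 1) :
    |1 - binomialLower m j x - m.choose j * x ^ j| ≤ 2 ^ m * (m + 1) * x ^ (j + 1) := by
  have hy := sub_nonneg.2 h1
  have hy1 : 1 - x ≤ 1 := by linarith
  have hsum : ∑ k ∈ Ico (j + 1) (m + 1), (m.choose k : ℝ) ≤ 2 ^ m := by
    rw [← Nat.cast_sum]
    exact_mod_cast (sum_le_sum_of_subset (fun k hk => mem_range.2 (mem_Ico.1 hk).2)).trans
      (Nat.sum_range_choose m).le
  have hT0 : 0 ≤ ∑ k ∈ Ico (j + 1) (m + 1), (m.choose k : ℝ) * x ^ k * (1 - x) ^ (m - k) :=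
    sum_nonneg fun _ _ => by positivity
  have hT : ∑ k ∈ Ico (j + 1) (m + 1), (m.choose k : ℝ) * x ^ k * (1 - x) ^ (m - k)
      ≤ 2 ^ m * x ^ (j + 1) := by
    refine le_trans ?_ (mul_le_mul_of_nonneg_right hsum (by positivity))
    rw [sum_mul]
    refine sum_le_sum fun k hk => ?_
    refine (mul_le_of_le_one_right (by positivity) (pow_le_one₀ hy hy1)).trans ?_
    exact mul_le_mul_of_nonneg_left (pow_le_pow_of_le_one h0 h1 (mem_Ico.1 hk).1) (by positivity)
  have hc : (m.choose j : ℝ) ≤ 2 ^ m := by exact_mod_cast Nat.choose_le_two_pow m j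
  have hb : 1 - (1 - x) ^ (m - j) ≤ m * x := by
    have := one_add_mul_le_pow (a := -x) (by linarith) (m - j)
    have hmj : ((m - j : ℕ) : ℝ) ≤ m := Nat.cast_le.2 (Nat.sub_le _ _)
    rw [← sub_eq_add_neg] at this
    nlinarith
  have hb0 : 0 ≤ 1 - (1 - x) ^ (m - j) := sub_nonneg.2 (pow_le_one₀ hy hy1)
  have hA : m.choose j * x ^ j * (1 - (1 - x) ^ (m - j)) ≤ 2 ^ m * m * x ^ (j + 1) := by
    calc _ ≤ 2 ^ m * x ^ j * (m * x) := by gcongr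
      _ = _ := by ring
  have hA0 : 0 ≤ m.choose j * x ^ j * (1 - (1 - x) ^ (m - j)) := by positivity
  rw [one_sub_binomialLower hj, sum_eq_sum_Ico_succ_bot (by omega), abs_le]
  constructor <;> linarith [pow_nonneg h0 (j + 1)]

end BinomialTail

/-! ### Laplace-type asymptotics of the level integrals -/

section Asymptotics

open MeasureTheory Set

theorem exp_neg_sub_one_add_le_sq {t : ℝ} (ht : 0 ≤ t) : |Real.exp (-t) - (1 - t)| ≤ t ^ 2 := by
  have h1 := Real.add_one_le_exp (-t)
  have h2 : Real.exp (-t) * (1 + t) ≤ 1 := by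
    have := mul_le_mul_of_nonneg_left (Real.add_one_le_exp t) (Real.exp_pos (-t)).le
    rwa [← Real.exp_add, neg_add_cancel, Real.exp_zero, add_comm t 1] at this
  have h3 : Real.exp (-t) ≤ 1 - t + t ^ 2 := by
    refine le_of_mul_le_mul_right (h2.trans ?_) (by linarith : 0 < 1 + t)
    nlinarith [pow_nonneg ht 3]
  rw [abs_le]
  constructor <;> nlinarith [sq_nonneg t]

/-- Restores the exponent `n = k + 1` after one of `n` factors has been spent, at the price of a
constant. -/
theorem exp_neg_pow_le {y : ℝ} (hy : y ≤ 1) (k : ℕ) :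
    Real.exp (-y) ^ k ≤ Real.exp 1 * Real.exp (-((k + 1 : ℕ) : ℝ) * y) := by
  rw [← Real.exp_nat_mul, ← Real.exp_add]
  refine Real.exp_le_exp.2 ?_
  push_cast
  linarith

/-- Two replacements: `1 / (1 - x)` by 1, one factor `Q` absorbing the singularity at 1, and then
`Q` by `exp (-(c * x ^ j))`, via `|a^n - b^n| ≤ n |a - b| max(|a|, |b|)^(n-1)`. -/
theorem abs_binomialLower_pow_div_sub_exp_le {m j n : ℕ} (hj1 : 1 ≤ j) (hj : j ≤ m) (hn : 1 ≤ n)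
    {x : ℝ} (h0 : 0 ≤ x) (h1 : x < 1) :
    |binomialLower m j x ^ n / (1 - x) - Real.exp (-(m.choose j * n : ℝ) * x ^ j)|
      ≤ j * Real.exp 1 * (x * Real.exp (-(n : ℝ) * x ^ j))
        + (2 ^ m * (m + 1) + (m.choose j : ℝ) ^ 2) * Real.exp 1 * n
          * (x ^ (j + 1) * Real.exp (-(n : ℝ) * x ^ j)) := by
  obtain ⟨k, rfl⟩ := Nat.exists_eq_add_of_le' hn
  set Q := binomialLower m j x with hQ
  set c : ℝ := (m.choose j : ℝ) with hc
  have hx : 0 < 1 - x := sub_pos.2 h1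
  have hy0 : 0 ≤ x ^ j := pow_nonneg h0 j
  have hy1 : x ^ j ≤ 1 := pow_le_one₀ h0 h1.le
  have hQ0 : 0 ≤ Q := binomialLower_nonneg m j h0 h1.le
  have hQ1 : Q ≤ 1 - x ^ j := binomialLower_le_one_sub_pow hj h0 h1.le
  have hc1 : 1 ≤ c := Nat.one_le_cast.2 (Nat.choose_pos hj)
  have hQe : Q ≤ Real.exp (-x ^ j) := by linarith [Real.add_one_le_exp (-x ^ j)]
  have hce : Real.exp (-(c * x ^ j)) ≤ Real.exp (-x ^ j) :=
    Real.exp_le_exp.2 (neg_le_neg (le_mul_of_one_le_left hy0 hc1))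
  have hek := exp_neg_pow_le hy1 k
  have first : |Q ^ (k + 1) / (1 - x) - Q ^ (k + 1)|
      ≤ j * Real.exp 1 * (x * Real.exp (-((k + 1 : ℕ) : ℝ) * x ^ j)) := by
    -- Bernoulli gives `1 - x ^ j ≤ j * (1 - x)`.
    have hdiv : Q / (1 - x) ≤ j := by
      rw [div_le_iff₀ hx]
      have := one_add_mul_le_pow (a := x - 1) (by linarith) j
      rw [add_sub_cancel] at this
      linarith
    have he : Q ^ (k + 1) / (1 - x) - Q ^ (k + 1) = Q / (1 - x) * (x * Q ^ k) := by
      field_simp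
      ring
    rw [he, abs_of_nonneg (by positivity)]
    calc Q / (1 - x) * (x * Q ^ k)
        ≤ j * (x * (Real.exp 1 * Real.exp (-((k + 1 : ℕ) : ℝ) * x ^ j))) := by
          gcongr
          exact (pow_le_pow_left₀ hQ0 hQe k).trans hek
      _ = _ := by ring
  have second : |Q ^ (k + 1) - Real.exp (-(c * (k + 1 : ℕ)) * x ^ j)|
      ≤ (2 ^ m * (m + 1) + c ^ 2) * Real.exp 1 * (k + 1 : ℕ)
          * (x ^ (j + 1) * Real.exp (-((k + 1 : ℕ) : ℝ) * x ^ j)) := by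
    have he : Real.exp (-(c * (k + 1 : ℕ)) * x ^ j) = Real.exp (-(c * x ^ j)) ^ (k + 1) := by
      rw [← Real.exp_nat_mul]
      congr 1
      ring
    have hd : |Q - Real.exp (-(c * x ^ j))| ≤ (2 ^ m * (m + 1) + c ^ 2) * x ^ (j + 1) := by
      have e1 := abs_one_sub_binomialLower_sub_le hj h0 h1.le
      have e2 := exp_neg_sub_one_add_le_sq (mul_nonneg (zero_le_one.trans hc1) hy0)
      have e3 : (c * x ^ j) ^ 2 ≤ c ^ 2 * x ^ (j + 1) := by
        rw [mul_pow, ← pow_mul]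
        exact mul_le_mul_of_nonneg_left (pow_le_pow_of_le_one h0 h1.le (by omega)) (sq_nonneg c)
      rw [abs_le] at e1 e2 ⊢
      constructor <;> linarith [e1.1, e1.2, e2.1, e2.2]
    have hmax : max |Q| |Real.exp (-(c * x ^ j))| ≤ Real.exp (-x ^ j) := by
      rw [abs_of_nonneg hQ0, Real.abs_exp]
      exact max_le hQe hce
    rw [he]
    refine (abs_pow_sub_pow_le _ _ (k + 1)).trans ?_
    rw [Nat.add_sub_cancel]
    calc |Q - Real.exp (-(c * x ^ j))| * (k + 1 : ℕ)
          * max |Q| |Real.exp (-(c * x ^ j))| ^ k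
        ≤ ((2 ^ m * (m + 1) + c ^ 2) * x ^ (j + 1)) * (k + 1 : ℕ)
          * (Real.exp 1 * Real.exp (-((k + 1 : ℕ) : ℝ) * x ^ j)) := by
          gcongr
          exact (pow_le_pow_left₀ (le_max_of_le_left (abs_nonneg _)) hmax k).trans hek
      _ = _ := by ring
  exact (abs_sub_le _ _ _).trans (add_le_add first second)

theorem integrableOn_pow_mul_exp_neg_mul_pow {j : ℕ} (hj : 1 ≤ j) (q : ℕ) {b : ℝ} (hb : 0 < b) :
    IntegrableOn (fun x : ℝ => x ^ q * Real.exp (-b * x ^ j)) (Ioi 0) := by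
  have := integrableOn_rpow_mul_exp_neg_mul_rpow (s := q) (p := j) (b := b)
    (by linarith [Nat.cast_nonneg (α := ℝ) q]) (Nat.cast_pos.2 hj) hb
  simpa only [Real.rpow_natCast] using this

theorem integral_pow_mul_exp_neg_mul_pow {j : ℕ} (hj : 1 ≤ j) (q : ℕ) {b : ℝ} (hb : 0 < b) :
    ∫ x in Ioi (0 : ℝ), x ^ q * Real.exp (-b * x ^ j)
      = b ^ (-((q : ℝ) + 1) / j) * (1 / j) * Real.Gamma (((q : ℝ) + 1) / j) := by
  have := integral_rpow_mul_exp_neg_mul_rpow (p := j) (q := q) (b := b) (Nat.cast_pos.2 hj)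
    (by linarith [Nat.cast_nonneg (α := ℝ) q]) hb
  simpa only [Real.rpow_natCast] using this

theorem integral_exp_neg_choose_mul_pow {m j n : ℕ} (hj1 : 1 ≤ j) (hj : j ≤ m) (hn : 1 ≤ n) :
    ∫ x in Ioi (0 : ℝ), Real.exp (-(m.choose j * n : ℝ) * x ^ j)
      = Real.Gamma (((j : ℝ) + 1) / j) / (deckGamma m j * (n : ℝ) ^ (1 / (j : ℝ))) := by
  have hc : (0 : ℝ) < m.choose j := Nat.cast_pos.2 (Nat.choose_pos hj)
  have hn' : (0 : ℝ) < n := Nat.cast_pos.2 hn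
  have hj' : (0 : ℝ) < j := Nat.cast_pos.2 hj1
  have := integral_exp_neg_mul_rpow (p := j) (b := m.choose j * n) hj' (mul_pos hc hn')
  simp only [Real.rpow_natCast] at this
  rw [this, div_eq_inv_mul (Real.Gamma _), deckGamma, ← Real.mul_rpow hc.le hn'.le,
    neg_div, Real.rpow_neg (by positivity),
    add_div, div_self hj'.ne', add_comm (1 : ℝ)]

/-- The contribution of level `j` agrees with its leading term up to `O(n ^ (-2 / j))`. -/
theorem exists_abs_integral_binomialLower_sub_le {m j : ℕ} (hj1 : 1 ≤ j) (hj : j ≤ m) :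
    ∃ K : ℝ, 0 ≤ K ∧ ∀ n : ℕ, 1 ≤ n →
      |(∫ x in (0 : ℝ)..1, binomialLower m j x ^ n / (1 - x))
        - Real.Gamma (((j : ℝ) + 1) / j) / (deckGamma m j * (n : ℝ) ^ (1 / (j : ℝ)))|
        ≤ K * (n : ℝ) ^ (-(2 / (j : ℝ))) := by
  have hj' : (0 : ℝ) < j := Nat.cast_pos.2 hj1
  set A : ℝ := j * Real.exp 1 with hA
  set B : ℝ := (2 ^ m * (m + 1) + (m.choose j : ℝ) ^ 2) * Real.exp 1 with hB
  have hB0 : 0 ≤ B := by positivity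
  have hA1 : 1 ≤ A :=
    one_le_mul_of_one_le_of_one_le (Nat.one_le_cast.2 hj1) (Real.one_le_exp zero_le_one)
  have hA0 : 0 ≤ A := zero_le_one.trans hA1
  -- These are the values of the two error integrals; both `x` and `n * x ^ (j + 1)` against `exp
  -- (-n * x ^ j)` scale as `n ^ (-2 / j)`.
  refine ⟨A * ((1 / j) * Real.Gamma (2 / j)) + B * ((1 / j) * Real.Gamma ((j + 2) / j)),
    ?_, fun n hn => ?_⟩
  · have h1 := (Real.Gamma_pos_of_pos (show (0 : ℝ) < 2 / j by positivity)).le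
    have h2 := (Real.Gamma_pos_of_pos (show (0 : ℝ) < (j + 2) / j by positivity)).le
    positivity
  have hn' : (0 : ℝ) < n := Nat.cast_pos.2 hn
  have hc1 : (1 : ℝ) ≤ m.choose j := Nat.one_le_cast.2 (Nat.choose_pos hj)
  have hcn : (0 : ℝ) < m.choose j * n := by positivity
  set F : ℝ → ℝ := (Iio 1).indicator fun x => binomialLower m j x ^ n / (1 - x) with hF
  set E : ℝ → ℝ := fun x => Real.exp (-(m.choose j * n : ℝ) * x ^ j) with hE
  set G : ℝ → ℝ := fun x => A * (x ^ 1 * Real.exp (-(n : ℝ) * x ^ j))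
    + B * n * (x ^ (j + 1) * Real.exp (-(n : ℝ) * x ^ j)) with hG
  have hFint : ∫ x in (0 : ℝ)..1, binomialLower m j x ^ n / (1 - x) = ∫ x in Ioi (0 : ℝ), F x := by
    rw [setIntegral_indicator measurableSet_Iio, Ioi_inter_Iio,
      intervalIntegral.integral_of_le zero_le_one, integral_Ioc_eq_integral_Ioo]
  have hi1 := integrableOn_pow_mul_exp_neg_mul_pow hj1 1 hn'
  have hi2 := integrableOn_pow_mul_exp_neg_mul_pow hj1 (j + 1) hn'
  have hGi : IntegrableOn G (Ioi 0) := (hi1.const_mul A).add (hi2.const_mul (B * n))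
  have hEi : IntegrableOn E (Ioi 0) := by
    simpa only [pow_zero, one_mul] using integrableOn_pow_mul_exp_neg_mul_pow hj1 0 hcn
  have hbound : ∀ x ∈ Ioi (0 : ℝ), ‖F x - E x‖ ≤ G x := by
    intro x hx
    have hx0 : (0 : ℝ) < x := hx
    rw [Real.norm_eq_abs]
    rcases lt_or_ge x 1 with h1 | h1
    · rw [hF, indicator_of_mem (mem_Iio.2 h1)]
      simpa only [hG, pow_one] using abs_binomialLower_pow_div_sub_exp_le hj1 hj hn hx0.le h1
    -- Beyond 1 only the exponential remains, and `A * x ≥ 1` lets the first error term absorb it: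
    -- no separate tail estimate is needed.
    · rw [hF, indicator_of_notMem (notMem_Iio.2 h1), zero_sub, abs_neg, abs_of_pos (Real.exp_pos _)]
      have hle : Real.exp (-(m.choose j * n : ℝ) * x ^ j) ≤ Real.exp (-(n : ℝ) * x ^ j) := by
        refine Real.exp_le_exp.2 ?_
        rw [neg_mul, neg_mul, neg_le_neg_iff]
        exact mul_le_mul_of_nonneg_right (le_mul_of_one_le_left hn'.le hc1) (by positivity)
      have hle2 : Real.exp (-(n : ℝ) * x ^ j) ≤ A * (x ^ 1 * Real.exp (-(n : ℝ) * x ^ j)) := by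
        rw [← mul_assoc, pow_one]
        exact le_mul_of_one_le_left (Real.exp_pos _).le (one_le_mul_of_one_le_of_one_le hA1 h1)
      exact (hle.trans hle2).trans (le_add_of_nonneg_right (by positivity))
  have hFm : Measurable F := by
    refine Measurable.indicator ?_ measurableSet_Iio
    unfold binomialLower
    fun_prop
  have hEm : Measurable E := by fun_prop
  have hae : ∀ᵐ x ∂volume.restrict (Ioi (0 : ℝ)), ‖F x - E x‖ ≤ G x :=
    (ae_restrict_iff' measurableSet_Ioi).2 (ae_of_all _ hbound)
  have hFE : IntegrableOn (fun x => F x - E x) (Ioi 0) :=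
    Integrable.mono' hGi (hFm.sub hEm).aestronglyMeasurable hae
  have hFi : IntegrableOn F (Ioi 0) := by
    refine (hFE.add hEi).congr (ae_of_all _ fun x => ?_)
    simp
  rw [hFint, ← integral_exp_neg_choose_mul_pow hj1 hj hn, ← integral_sub hFi hEi,
    ← Real.norm_eq_abs]
  refine (norm_integral_le_of_norm_le hGi hae).trans (le_of_eq ?_)
  rw [integral_add (hi1.const_mul A) (hi2.const_mul (B * n)), integral_const_mul,
    integral_const_mul, integral_pow_mul_exp_neg_mul_pow hj1 1 hn',
    integral_pow_mul_exp_neg_mul_pow hj1 (j + 1) hn']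
  have e1 : -(((1 : ℕ) : ℝ) + 1) / j = -(2 / j) := by
    push_cast
    ring
  have e2 : (n : ℝ) * (n : ℝ) ^ (-(((j + 1 : ℕ) : ℝ) + 1) / j) = (n : ℝ) ^ (-(2 / (j : ℝ))) := by
    rw [← Real.rpow_one_add' hn'.le]
    · congr 1
      push_cast
      field_simp
      ring
    · push_cast
      field_simp
      ring_nf
      norm_num
      omega
  have e3 : ((1 : ℕ) : ℝ) + 1 = 2 := by norm_num
  have e4 : ((j + 1 : ℕ) : ℝ) + 1 = j + 2 := by
    push_cast
    ring
  rw [e1, e3, ← e2, e4]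
  ring

end Asymptotics

/-! ### Summing the levels -/

section Expansion

open Finset

/-- The leading term of the contribution of level `j`. -/
noncomputable def levelTerm (m j n : ℕ) : ℝ :=
  Real.Gamma (((j : ℝ) + 1) / j) / (deckGamma m j * (n : ℝ) ^ (1 / (j : ℝ)))

theorem levelTerm_eq (m j n : ℕ) :
    levelTerm m j n
      = Real.Gamma (((j : ℝ) + 1) / j) / deckGamma m j * (n : ℝ) ^ (-(1 / (j : ℝ))) := by
  rw [levelTerm, Real.rpow_neg (Nat.cast_nonneg n), div_mul_eq_div_div, div_eq_mul_inv _ (_ ^ _)]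

theorem deckGamma_nonneg (m j : ℕ) : 0 ≤ deckGamma m j :=
  Real.rpow_nonneg (Nat.cast_nonneg _) _

theorem Gamma_succ_div_self_pos {j : ℕ} (hj : 1 ≤ j) : 0 < Real.Gamma (((j : ℝ) + 1) / j) :=
  have : (0 : ℝ) < j := Nat.cast_pos.2 hj
  Real.Gamma_pos_of_pos (by positivity)

/-- For `2 * j ≤ m` the main term has order `n ^ (-1 / j) ≤ n ^ (-2 / m)` and joins the error. -/
theorem exists_abs_integral_sub_levelTerm_le {m j : ℕ} (hj1 : 1 ≤ j) (hj : j ≤ m) :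
    ∃ K : ℝ, 0 ≤ K ∧ ∀ n : ℕ, 1 ≤ n →
      |(∫ x in (0 : ℝ)..1, binomialLower m j x ^ n / (1 - x))
        - (if m / 2 + 1 ≤ j then levelTerm m j n else 0)| ≤ K * (n : ℝ) ^ (-(2 / (m : ℝ))) := by
  have hj' : (0 : ℝ) < j := Nat.cast_pos.2 hj1
  obtain ⟨K, hK, h⟩ := exists_abs_integral_binomialLower_sub_le hj1 hj
  have hpow : ∀ n : ℕ, 1 ≤ n → (n : ℝ) ^ (-(2 / (j : ℝ))) ≤ (n : ℝ) ^ (-(2 / (m : ℝ))) := by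
    intro n hn
    refine Real.rpow_le_rpow_of_exponent_le (Nat.one_le_cast.2 hn) (neg_le_neg ?_)
    exact div_le_div_of_nonneg_left zero_le_two hj' (Nat.cast_le.2 hj)
  by_cases hjm : m / 2 + 1 ≤ j
  · refine ⟨K, hK, fun n hn => ?_⟩
    rw [if_pos hjm]
    exact (h n hn).trans (mul_le_mul_of_nonneg_left (hpow n hn) hK)
  · set L := Real.Gamma (((j : ℝ) + 1) / j) / deckGamma m j with hL
    have hL0 : 0 ≤ L := div_nonneg (Gamma_succ_div_self_pos hj1).le (deckGamma_nonneg m j)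
    refine ⟨K + L, add_nonneg hK hL0, fun n hn => ?_⟩
    have hn0 : (0 : ℝ) ≤ n := Nat.cast_nonneg n
    have hlead : levelTerm m j n ≤ L * (n : ℝ) ^ (-(2 / (m : ℝ))) := by
      rw [levelTerm_eq]
      refine mul_le_mul_of_nonneg_left ?_ hL0
      refine Real.rpow_le_rpow_of_exponent_le (Nat.one_le_cast.2 hn) (neg_le_neg ?_)
      have hm : (0 : ℝ) < m := hj'.trans_le (Nat.cast_le.2 hj)
      rw [div_le_div_iff₀ hm hj', one_mul]
      have : 2 * j ≤ m := by omega
      exact_mod_cast this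
    have hlead0 : 0 ≤ levelTerm m j n := by
      rw [levelTerm_eq]
      positivity
    have h1 := (h n hn).trans (mul_le_mul_of_nonneg_left (hpow n hn) hK)
    change |_ - levelTerm m j n| ≤ _ at h1
    rw [if_neg hjm, sub_zero, add_mul]
    rw [abs_le] at h1 ⊢
    constructor <;> linarith [h1.1, h1.2]

theorem exists_abs_worstExpected_sub_le (m : ℕ) :
    ∃ K : ℝ, 0 ≤ K ∧ ∀ n : ℕ, 1 ≤ n →
      |worstExpected n m - ∑ j ∈ Icc (m / 2 + 1) m, levelTerm m j n|
        ≤ K * (n : ℝ) ^ (-(2 / (m : ℝ))) := by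
  -- The membership sits under the existential so that `choose` yields a constant for every `j`.
  have h : ∀ j : ℕ, ∃ K : ℝ, j ∈ Icc 1 m → 0 ≤ K ∧ ∀ n : ℕ, 1 ≤ n →
      |(∫ x in (0 : ℝ)..1, binomialLower m j x ^ n / (1 - x))
        - (if m / 2 + 1 ≤ j then levelTerm m j n else 0)| ≤ K * (n : ℝ) ^ (-(2 / (m : ℝ))) := by
    intro j
    by_cases hj : j ∈ Icc 1 m
    · obtain ⟨K, hK⟩ := exists_abs_integral_sub_levelTerm_le (mem_Icc.1 hj).1 (mem_Icc.1 hj).2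
      exact ⟨K, fun _ => hK⟩
    · exact ⟨0, fun h => absurd h hj⟩
  choose K hK using h
  refine ⟨∑ j ∈ Icc 1 m, K j, sum_nonneg fun j hj => (hK j hj).1, fun n hn => ?_⟩
  have hIcc : Icc (m / 2 + 1) m = (Icc 1 m).filter fun j => m / 2 + 1 ≤ j := by
    ext j
    simp only [mem_Icc, mem_filter]
    omega
  rw [worstExpected_eq_sparseSum m hn, sparseSum_eq_sum_integral m hn, hIcc, sum_filter,
    ← sum_sub_distrib, sum_mul]
  exact (abs_sum_le_sum_abs _ _).trans (sum_le_sum fun j hj => (hK j hj).2 n hn)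

theorem isLittleO_natCast_rpow {a b : ℝ} (h : a < b) :
    (fun n : ℕ => (n : ℝ) ^ a) =o[atTop] fun n : ℕ => (n : ℝ) ^ b := by
  refine (isLittleO_of_tendsto' ?_ ?_ : (fun x : ℝ => x ^ a) =o[atTop] fun x : ℝ => x ^ b
    ).comp_tendsto tendsto_natCast_atTop_atTop
  · filter_upwards [eventually_gt_atTop 0] with x hx hx0
    exact absurd hx0 (Real.rpow_pos_of_pos hx b).ne'
  · refine (tendsto_rpow_neg_atTop (sub_pos.2 h)).congr' ?_
    filter_upwards [eventually_gt_atTop 0] with x hx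
    rw [← Real.rpow_sub hx, neg_sub]

theorem levelTerm_self (m n : ℕ) :
    levelTerm m m n = Real.Gamma (((m : ℝ) + 1) / m) * (n : ℝ) ^ (-(1 / (m : ℝ))) := by
  rw [levelTerm_eq, deckGamma, Nat.choose_self, Nat.cast_one, Real.one_rpow, div_one]

/-- Both the error and the main terms with `j < m` are of smaller order than `n ^ (-1 / m)`. -/
theorem worstExpected_isEquivalent {m : ℕ} (hm : 1 ≤ m) :
    (fun n : ℕ => worstExpected n m) ~[atTop]
      (fun n : ℕ => Real.Gamma (((m : ℝ) + 1) / (m : ℝ)) * (n : ℝ) ^ (-(1 / (m : ℝ)))) := by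
  have hm' : (0 : ℝ) < m := Nat.cast_pos.2 hm
  obtain ⟨K, -, hK⟩ := exists_abs_worstExpected_sub_le m
  have hΓ := (Gamma_succ_div_self_pos hm).ne'
  have h1 : (fun n : ℕ => worstExpected n m - ∑ j ∈ Icc (m / 2 + 1) m, levelTerm m j n)
      =o[atTop] fun n : ℕ => (n : ℝ) ^ (-(1 / (m : ℝ))) := by
    refine IsBigO.trans_isLittleO (g := fun n : ℕ => (n : ℝ) ^ (-(2 / (m : ℝ)))) ?_
      (isLittleO_natCast_rpow (neg_lt_neg (div_lt_div_of_pos_right one_lt_two hm')))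
    refine IsBigO.of_bound K ?_
    filter_upwards [eventually_ge_atTop 1] with n hn
    rw [Real.norm_eq_abs, Real.norm_of_nonneg (by positivity)]
    exact hK n hn
  have h2 : (fun n : ℕ => ∑ j ∈ (Icc (m / 2 + 1) m).erase m, levelTerm m j n)
      =o[atTop] fun n : ℕ => (n : ℝ) ^ (-(1 / (m : ℝ))) := by
    refine IsLittleO.fun_sum fun j hj => ?_
    rw [mem_erase, mem_Icc] at hj
    have hj0 : (0 : ℝ) < j := Nat.cast_pos.2 (by omega)
    have hjm : (j : ℝ) < m := Nat.cast_lt.2 (lt_of_le_of_ne hj.2.2 hj.1)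
    exact ((isLittleO_natCast_rpow (neg_lt_neg (one_div_lt_one_div_of_lt hj0 hjm))).const_mul_left
      _).congr_left fun n => (levelTerm_eq m j n).symm
  refine IsLittleO.const_mul_right hΓ ((h1.add h2).congr_left fun n => ?_)
  rw [← add_sum_erase _ _ (mem_Icc.2 ⟨by omega, le_rfl⟩ : m ∈ Icc (m / 2 + 1) m), levelTerm_self]
  simp only [Pi.sub_apply]
  ring

end Expansion

theorem mainTheorem4 (m : ℕ) (hm : 1 ≤ m) :
    (∀ n : ℕ, 1 ≤ n →
      IsLeast (Set.range (expectedCorrect n m)) (worstExpected n m)) ∧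
    (∃ C : ℝ, ∀ n : ℕ, 2 ≤ n →
      |worstExpected n m -
          ∑ j ∈ Finset.Icc (m / 2 + 1) m,
            Real.Gamma (((j : ℝ) + 1) / (j : ℝ)) /
              (deckGamma m j * (n : ℝ) ^ (1 / (j : ℝ)))| ≤
        C * ((n : ℝ) ^ (-(2 / (m : ℝ))) * Real.log (n : ℝ) ^ 2)) ∧
    (fun n : ℕ => worstExpected n m) ~[atTop]
      (fun n : ℕ => Real.Gamma (((m : ℝ) + 1) / (m : ℝ)) * (n : ℝ) ^ (-(1 / (m : ℝ)))) := by
  refine ⟨fun n hn => ?_, ?_, worstExpected_isEquivalent hm⟩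
  · rw [worstExpected_eq_sparseSum m hn]
    exact isLeast_sparseSum m hn
  · obtain ⟨K, hK0, hK⟩ := exists_abs_worstExpected_sub_le m
    have hlog : 0 < Real.log 2 := Real.log_pos one_lt_two
    -- The bound already holds without the logarithm; for `n ≥ 2` the factor `log n ^ 2` is at least
    -- `log 2 ^ 2`.
    refine ⟨K / Real.log 2 ^ 2, fun n hn => (hK n (by omega)).trans ?_⟩
    have hle : Real.log 2 ^ 2 ≤ Real.log n ^ 2 :=
      pow_le_pow_left₀ hlog.le (Real.log_le_log two_pos (Nat.ofNat_le_cast.2 hn)) 2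
    rw [div_mul_eq_mul_div, le_div_iff₀ (by positivity), mul_assoc]
    gcongr
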